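/- **Setting.** Let $V$ be a set of $n=n_1+n_2$ storage nodes, $V=U\sqcup L$ with $|U|=n_1\ge 2$, $|L|=n_2\ge 2$, let $n_1<k\le n$ and put $a=k-n_1$. Let $\beta_1\ge\beta_2>0$ and put $\beta(v)=\beta_1$ for $v\in U$, $\beta(v)=\beta_2$ for $v\in L$. For a sequence $s=(s_1,s_2,\dots)\in V^\infty$ of failed nodes, the information flow graphs $\mathcal X_0\subset\mathcal X_1\subset\cdots$ are defined as follows. $\mathcal X_0$ has a source $\tilde v$ joined to every node of $V$, and all nodes of $V$ are active. At the $j$-th failure ($j\ge1$) two vertices are added, a repair unit $CU_j$ and a newcomer $s_j^{\,j}$; the active copy of every node other than $s_j$ is joined to $CU_j$, $CU_j$ is joined to $s_j^{\,j}$, and $s_j^{\,j}$ replaces the previous copy of $s_j$ among the active nodes. A weight function is a sequence $h=(h_j)_{j\ge1}$ of functions $h_j:V\to[0,\infty)$; the edge from the copy of $v$ to $CU_j$ has weight $h_j(v)$, and all other edges have infinite weight (unlimited storage at the nodes). The $h$-capacity $\mathsf{cap}_h$ is the minimum weight, over all $j\ge 0$ and all sets $D$ of $k$ active nodes of $\mathcal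 X_j$, of a cut between $\tilde v$ and $D$ in $\mathcal X_j$ (the largest file size that can be retrieved at all times from any $k$ active nodes). The capacity $\mathsf{cap}$ of the network is the supremum of $\mathsf{cap}_h$ over all $h$ that satisfy the average bandwidth constraints $\limsup_{l\to\infty}\frac1l\sum_{j=1}^l h_j(v)\le\beta(v)$ for all $v\in V$. Let $h^*_j(v)=\beta(v)$ if $v\ne s_j$ and $h^*_j(s_j)=0$. The static capacity $C$ is the minimum, over all $s\in V^\infty$, all $j\ge0$ and all sets $D$ of $k$ active nodes of $\mathcal X_j$, of the minimum weight under $h^*$ of a cut in $\mathcal X_j$ separating $D$ from $\tilde v$ and all formerly active, no longer active nodes. **Theorem.** Let $\varepsilon_1\ge0$ satisfy $$\beta_1-\beta_2\ \ge\ \frac{n(n_1-1)}{n_2}\,\varepsilon_1 ,$$ and let the failed nodes $\boldsymbol S=(\boldsymbol S_1,\boldsymbol S_2,\dots)$ be independent and uniformly distributed on $V$. Then $$C=\frac{n_1(n_1-1)}2\beta_1+\Big(n_2(n_1+a)-\frac{a(a+1)}2\Big)\beta_2 ,$$ and, almost surely, $$\mathsf{cap}\ \ge\ C+\frac{n_1(n_1-1)}2\,\varepsilon_1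 .$$ Moreover, this is achieved by the following protocol $h$: when $\boldsymbol S_j\in U$, put $h_j=h_U$ with $h_U(v)=\beta_1+\varepsilon_1$ for $v\in U\setminus\{\boldsymbol S_j\}$, $h_U(v)=\beta_2$ for $v\in L$, $h_U(\boldsymbol S_j)=0$; when $\boldsymbol S_j\in L$, put $h_j=h_L$ with $h_L(v)=\beta_1-\frac{n_1-1}{n_2}\varepsilon_1$ for $v\in U$, $h_L(v)=\beta_2$ for $v\in L\setminus\{\boldsymbol S_j\}$, $h_L(\boldsymbol S_j)=0$. Almost surely, $h$ is nonnegative, satisfies the average bandwidth constraints, and $\mathsf{cap}_h\ge C+\frac{n_1(n_1-1)}2\varepsilon_1$. -/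

import Mathlib

open scoped ENNReal BigOperators
open Filter MeasureTheory ProbabilityTheory

noncomputable section

namespace StorageNetwork

/-- Vertices of the information flow graphs of a network with set of storage nodes `V`.
`storage v 0` is the original node `v`, and `storage v (i + 1)` is the newcomer that replaces `v`
after failure number `i`.  `repair i` is the centralized unit `CU` that repairs failure number `i`.
Failures are numbered `0, 1, 2, …`. -/
inductive FlowNode (V : Type*) where
  | source : FlowNode V
  | storage (v : V) (i : ℕ) : FlowNode V
  | repair (i : ℕ) : FlowNode V
  deriving DecidableEq

variable {V : Type*} [Fintype V] [DecidableEq V]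

/-- The superscript of the active copy of the node `v` after the first `j` failures, when `s i` is
the node hit by failure number `i`. -/
def label (s : ℕ → V) : ℕ → V → ℕ
  | 0, _ => 0
  | j + 1, v => if v = s j then j + 1 else label s j v

/-- The set of active nodes after the first `j` failures. -/
def activeNodes (s : ℕ → V) (j : ℕ) : Finset (FlowNode V) :=
  Finset.univ.image fun v => FlowNode.storage v (label s j v)

/-- The vertex set of the information flow graph after `j` failures. -/
def flowVertices (s : ℕ → V) : ℕ → Finset (FlowNode V)
  | 0 => insert FlowNode.source (Finset.univ.image fun v => FlowNode.storage v 0)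
  | j + 1 => flowVertices s j ∪ {FlowNode.repair j, FlowNode.storage (s j) (j + 1)}

/-- The (directed) edge set of the information flow graph after `j` failures: the active copy of
every node other than the failed one is joined to the repair unit, which is joined to the
newcomer. -/
def flowEdges (s : ℕ → V) : ℕ → Finset (FlowNode V × FlowNode V)
  | 0 => Finset.univ.image fun v => (FlowNode.source, FlowNode.storage v 0)
  | j + 1 => flowEdges s j
      ∪ (Finset.univ.filter fun u => u ≠ s j).image
          (fun u => (FlowNode.storage u (label s j u), FlowNode.repair j))
      ∪ {(FlowNode.repair j, FlowNode.storage (s j) (j + 1))}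

/-- Edge weights.  The edge from a copy of `v` to the repair unit of failure `i` carries `h i v`
symbols.  The other edges (source to original node, repair unit to newcomer) are unrestricted,
because a storage node can hold any amount of information. -/
def edgeWeight (h : ℕ → V → ℝ) : FlowNode V × FlowNode V → ℝ≥0∞
  | (FlowNode.storage v _, FlowNode.repair i) => ENNReal.ofReal (h i v)
  | _ => ⊤

/-- The weight of the cut whose second (sink) part is `T`. -/
def cutWeight (s : ℕ → V) (h : ℕ → V → ℝ) (j : ℕ) (T : Finset (FlowNode V)) : ℝ≥0∞ :=
  ∑ e ∈ (flowEdges s j).filter (fun e => e.1 ∉ T ∧ e.2 ∈ T), edgeWeight h e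

/-- The minimum weight of a cut between `A` and `D` in the information flow graph after `j`
failures: the vertices are split into two parts, the first contains `A`, the second contains `D`. -/
def minCut (s : ℕ → V) (h : ℕ → V → ℝ) (j : ℕ) (A D : Finset (FlowNode V)) : ℝ≥0∞ :=
  ⨅ (T : Finset (FlowNode V)) (_ : T ⊆ flowVertices s j) (_ : Disjoint A T) (_ : D ⊆ T),
    cutWeight s h j T

/-- The `h`-capacity: the largest file size that can be retrieved at all times from every choice of
`k` active nodes, that is, the minimum weight of a cut between the source and `k` active nodes,
over all times. -/
def capWith (k : ℕ) (s : ℕ → V) (h : ℕ → V → ℝ) : ℝ≥0∞ :=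
  ⨅ (j : ℕ) (D : Finset (FlowNode V)) (_ : D ∈ (activeNodes s j).powersetCard k),
    minCut s h j {FlowNode.source} D

/-- The weight functions that satisfy the average bandwidth constraints `β`. -/
def Admissible (β : V → ℝ) (h : ℕ → V → ℝ) : Prop :=
  (∀ j v, 0 ≤ h j v) ∧
    ∀ v, limsup (fun l : ℕ => (((∑ j ∈ Finset.range l, h j v) / (l : ℝ) : ℝ) : EReal)) atTop
      ≤ ((β v : ℝ) : EReal)

/-- The storage capacity for the failure sequence `s`. -/
def cap (k : ℕ) (β : V → ℝ) (s : ℕ → V) : ℝ≥0∞ :=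
  ⨆ (h : ℕ → V → ℝ) (_ : Admissible β h), capWith k s h

/-- The weight function `h*`: every helper node `v` always transmits `β v` symbols. -/
def hStar (β : V → ℝ) (s : ℕ → V) (j : ℕ) (v : V) : ℝ :=
  if v = s j then 0 else β v

/-- The cut `C_t^h` after `j` failures: the minimum, over the choices of `k` active nodes, of the
minimum cut between all vertices that were active earlier, with the source, but are not active now,
and the chosen nodes. -/
def cutAt (k : ℕ) (s : ℕ → V) (h : ℕ → V → ℝ) (j : ℕ) : ℝ≥0∞ :=
  ⨅ (D : Finset (FlowNode V)) (_ : D ∈ (activeNodes s j).powersetCard k),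
    minCut s h j
      (insert FlowNode.source ((Finset.range j).biUnion (activeNodes s)) \ activeNodes s j) D

/-- The static (worst-case) minimum cut: the minimum of `C_t` under `h*` over all times and all
failure sequences. -/
def staticCut (k : ℕ) (β : V → ℝ) : ℝ≥0∞ :=
  ⨅ (s : ℕ → V) (j : ℕ), cutAt k s (hStar β s) j

/-- The bandwidth constraints of the fixed-cost network: `β₁` on `U` and `β₂` on `L = Uᶜ`. -/
def fixedCost (U : Finset V) (β₁ β₂ : ℝ) (v : V) : ℝ :=
  if v ∈ U then β₁ else β₂

/-- The amounts `h_U` transmitted when the failed node `x` lies in `U`. -/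
def protocolU (U : Finset V) (β₁ β₂ ε₁ : ℝ) (x v : V) : ℝ :=
  if v = x then 0 else if v ∈ U then β₁ + ε₁ else β₂

/-- The amounts `h_L` transmitted when the failed node `x` lies in `L = Uᶜ`. -/
def protocolL (U : Finset V) (β₁ β₂ ε₁ : ℝ) (x v : V) : ℝ :=
  if v = x then 0
  else if v ∈ U then β₁ - ((U.card : ℝ) - 1) / (Uᶜ.card : ℝ) * ε₁ else β₂

/-- The transmission protocol: `h_U` if the failed node is in `U`, and `h_L` otherwise. -/
def protocol (U : Finset V) (β₁ β₂ ε₁ : ℝ) (s : ℕ → V) (j : ℕ) (v : V) : ℝ :=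
  if s j ∈ U then protocolU U β₁ β₂ ε₁ (s j) v else protocolL U β₁ β₂ ε₁ (s j) v

end StorageNetwork

end

namespace StorageNetwork

variable {V : Type*} [Fintype V] [DecidableEq V]

/-! Follow a cut of finite weight, with sink part `T`, failure by failure. No original node lies in
`T`, and a newcomer in `T` has its repair unit in `T`, since otherwise an infinite edge is cut. Let
`B` collect the failed nodes whose repair units lie in `T`. A node outside `B` has its active copy
outside `T`, so each new member of `B` pays for downloads from everything else outside `B`.

For a pair `u ∈ U`, `l ∈ L`, collecting `u` first costs `β₂`, and collecting `l` first costs the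
`h_L` amount sent by `u`, which is at least `β₂`. Hence collecting `U` before `L` is cheapest, and
the cut weighs at least `collectCost` at `x = |B ∩ U|`, `y = |B ∩ L|`
(`exists_collectCost_le_cutWeight`). As `k` active nodes lie in `T`, `x + y ≥ k`; by
`le_collectCost` the bound is then smallest at `x = n₁`, `y = k - n₁`. There the downloads within
`U` yield the gain, and no node of `L` downloads from `U`, so the reduction in `h_L` costs nothing.

This holds for every failure sequence. At `ε₁ = 0` it bounds the static cut from below, and failing
`U` first, then `L`, without repetition attains it (`staticCut_le`). Randomness enters only through
admissibility: by the strong law the average use of each node tends to `(n - 1) / n` times its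
budget. -/

/-! ### Cut weights, failure by failure -/

/-- The total weight of the edges that enter the repair unit of failure `j` across the cut with
second part `T`. -/
noncomputable def repairCost (s : ℕ → V) (h : ℕ → V → ℝ) (j : ℕ) (T : Finset (FlowNode V)) :
    ℝ≥0∞ :=
  ∑ u ∈ Finset.univ.filter (fun u => u ≠ s j ∧ FlowNode.storage u (label s j u) ∉ T),
    ENNReal.ofReal (h j u)

lemma lt_of_repair_mem_flowEdges {s : ℕ → V} {j i : ℕ} {e : FlowNode V × FlowNode V}
    (he : e ∈ flowEdges s j) (hi : e.1 = FlowNode.repair i ∨ e.2 = FlowNode.repair i) : i < j := by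
  induction j with
  | zero =>
    simp only [flowEdges, Finset.mem_image, Finset.mem_univ, true_and] at he
    obtain ⟨v, rfl⟩ := he
    simp at hi
  | succ j ih =>
    simp only [flowEdges, Finset.mem_union, Finset.mem_image, Finset.mem_filter, Finset.mem_univ,
      true_and, Finset.mem_singleton] at he
    rcases he with (he | ⟨u, _, rfl⟩) | rfl
    · exact (ih he).trans (Nat.lt_succ_self j)
    · simp at hi; omega
    · simp at hi; omega

lemma cutWeight_zero (s : ℕ → V) (h : ℕ → V → ℝ) {T : Finset (FlowNode V)}
    (hT : FlowNode.source ∉ T) :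
    cutWeight s h 0 T = ∑ v : V, if FlowNode.storage v 0 ∈ T then ⊤ else 0 := by
  unfold cutWeight flowEdges
  rw [Finset.sum_filter, Finset.sum_image (by intro a _ b _ hab; simpa using hab)]
  refine Finset.sum_congr rfl fun v _ => ?_
  simp [hT, edgeWeight]

lemma cutWeight_succ (s : ℕ → V) (h : ℕ → V → ℝ) (j : ℕ) (T : Finset (FlowNode V)) :
    cutWeight s h (j + 1) T = cutWeight s h j T
      + (if FlowNode.repair j ∈ T then repairCost s h j T else 0)
      + (if FlowNode.repair j ∉ T ∧ FlowNode.storage (s j) (j + 1) ∈ T then ⊤ else 0) := by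
  unfold cutWeight
  simp only [Finset.sum_filter, flowEdges]
  rw [Finset.sum_union, Finset.sum_union, Finset.sum_singleton]
  · congr 2
    rw [Finset.sum_image (by intro a _ b _ hab; simp at hab; exact hab.1)]
    by_cases hr : FlowNode.repair j ∈ T
    · simp only [hr, and_true, if_true, edgeWeight, repairCost]
      rw [← Finset.sum_filter, Finset.filter_filter]
    · simp [hr]
  · rw [Finset.disjoint_left]
    intro e he he'
    obtain ⟨u, _, rfl⟩ := Finset.mem_image.1 he'
    exact lt_irrefl _ (lt_of_repair_mem_flowEdges (i := j) he (Or.inr rfl))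
  · rw [Finset.disjoint_singleton_right, Finset.mem_union, not_or]
    refine ⟨fun he => lt_irrefl _ (lt_of_repair_mem_flowEdges (i := j) he (Or.inl rfl)), ?_⟩
    simp

/-! ### Lower bound for every cut -/

/-- The cost of collecting `x` nodes of `U` followed by `y` nodes of `L`, when each new node of `U`
downloads `b` from every missing node of `U`, each new node of `L` downloads `g` from every missing
node of `U`, and both download `c` from every missing node of `L`. -/
noncomputable def collectCost (m₁ m₂ b g c x y : ℝ) : ℝ :=
  b * (m₁ * (m₁ - 1) / 2 - (m₁ - x) * (m₁ - x - 1) / 2) + x * m₂ * c + y * g * (m₁ - x)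
    + c * (m₂ * y - y * (y + 1) / 2)

/-- Moving the new node of `U` ahead of the `y` collected nodes of `L` saves `g` and costs `c` for
each of them; the slack is `y * (g - c)`. -/
lemma collectCost_add_left_le {m₁ m₂ b g c x y : ℝ} (hgc : c ≤ g) (hy : 0 ≤ y) :
    collectCost m₁ m₂ b g c (x + 1) y
      ≤ collectCost m₁ m₂ b g c x y + (b * (m₁ - x - 1) + c * (m₂ - y)) := by
  unfold collectCost
  nlinarith [mul_nonneg hy (sub_nonneg.2 hgc)]

lemma collectCost_add_right (m₁ m₂ b g c x y : ℝ) :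
    collectCost m₁ m₂ b g c x (y + 1)
      = collectCost m₁ m₂ b g c x y + (g * (m₁ - x) + c * (m₂ - y - 1)) := by
  unfold collectCost
  ring

lemma sum_protocol_of_mem (U B : Finset V) (β₁ β₂ ε₁ : ℝ) {s : ℕ → V} {j : ℕ}
    (hs : s j ∈ U) (hB : s j ∉ B) :
    ∑ u ∈ Finset.univ.filter (fun u => u ≠ s j ∧ u ∉ B), protocol U β₁ β₂ ε₁ s j u
      = (β₁ + ε₁) * (U.card - (B ∩ U).card - 1) + β₂ * (Uᶜ.card - (B ∩ Uᶜ).card) := by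
  have hsplit : Finset.univ.filter (fun u => u ≠ s j ∧ u ∉ B)
      = ((U \ B).erase (s j)) ∪ (Uᶜ \ B) := by
    ext u
    by_cases hu : u ∈ U
    · simp [hu]
    · simp [hu]
      rintro - rfl
      exact hu hs
  have hdisj : Disjoint ((U \ B).erase (s j)) (Uᶜ \ B) := by
    rw [Finset.disjoint_left]
    intro u h1 h2
    simp at h1 h2
    exact h2.1 h1.2.1
  have c1 : (((U \ B).erase (s j)).card : ℝ) = U.card - (B ∩ U).card - 1 := by
    rw [Finset.cast_card_erase_of_mem (by simp [hs, hB])]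
    have := Finset.card_sdiff_add_card_inter U B
    rw [Finset.inter_comm] at this
    rw [← this]; push_cast; ring
  have c2 : (((Uᶜ \ B)).card : ℝ) = Uᶜ.card - (B ∩ Uᶜ).card := by
    have := Finset.card_sdiff_add_card_inter Uᶜ B
    rw [Finset.inter_comm] at this
    rw [← this]; push_cast; ring
  rw [hsplit, Finset.sum_union hdisj, ← c1, ← c2,
    Finset.sum_congr rfl (g := fun _ => β₁ + ε₁),
    Finset.sum_congr rfl (s₁ := Uᶜ \ B) (g := fun _ => β₂)]
  · simp only [Finset.sum_const, nsmul_eq_mul]; ring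
  · intro u hu
    simp only [Finset.mem_sdiff, Finset.mem_compl] at hu
    have : u ≠ s j := by rintro rfl; exact hu.1 hs
    simp [protocol, protocolU, hs, hu.1, this]
  · intro u hu
    simp only [Finset.mem_sdiff, Finset.mem_erase] at hu
    simp [protocol, protocolU, hs, hu.1, hu.2.1]

lemma sum_protocol_of_notMem (U B : Finset V) (β₁ β₂ ε₁ : ℝ) {s : ℕ → V} {j : ℕ}
    (hs : s j ∉ U) (hB : s j ∉ B) :
    ∑ u ∈ Finset.univ.filter (fun u => u ≠ s j ∧ u ∉ B), protocol U β₁ β₂ ε₁ s j u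
      = (β₁ - ((U.card : ℝ) - 1) / (Uᶜ.card : ℝ) * ε₁) * (U.card - (B ∩ U).card)
        + β₂ * (Uᶜ.card - (B ∩ Uᶜ).card - 1) := by
  have hsplit : Finset.univ.filter (fun u => u ≠ s j ∧ u ∉ B)
      = (U \ B) ∪ ((Uᶜ \ B).erase (s j)) := by
    ext u
    by_cases hu : u ∈ U
    · simp [hu]
      rintro - rfl
      exact hs hu
    · simp [hu]
  have hdisj : Disjoint (U \ B) ((Uᶜ \ B).erase (s j)) := by
    rw [Finset.disjoint_left]
    intro u h1 h2
    simp at h1 h2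
    exact h2.2.1 h1.1
  have c1 : (((Uᶜ \ B).erase (s j)).card : ℝ) = Uᶜ.card - (B ∩ Uᶜ).card - 1 := by
    rw [Finset.cast_card_erase_of_mem (by simp [hs, hB])]
    have := Finset.card_sdiff_add_card_inter Uᶜ B
    rw [Finset.inter_comm] at this
    rw [← this]; push_cast; ring
  have c2 : (((U \ B)).card : ℝ) = U.card - (B ∩ U).card := by
    have := Finset.card_sdiff_add_card_inter U B
    rw [Finset.inter_comm] at this
    rw [← this]; push_cast; ring
  rw [hsplit, Finset.sum_union hdisj, ← c1, ← c2,
    Finset.sum_congr rfl (g := fun _ => β₁ - ((U.card : ℝ) - 1) / (Uᶜ.card : ℝ) * ε₁),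
    Finset.sum_congr rfl (s₁ := (Uᶜ \ B).erase (s j)) (g := fun _ => β₂)]
  · simp only [Finset.sum_const, nsmul_eq_mul]; ring
  · intro u hu
    simp only [Finset.mem_sdiff, Finset.mem_compl, Finset.mem_erase] at hu
    simp [protocol, protocolL, hs, hu.1, hu.2.1]
  · intro u hu
    simp only [Finset.mem_sdiff] at hu
    have : u ≠ s j := by rintro rfl; exact hs hu.1
    simp [protocol, protocolL, hs, hu.1, this]

lemma protocol_nonneg {U : Finset V} {β₁ β₂ ε₁ : ℝ} (hβ₁ : 0 ≤ β₁) (hβ₂ : 0 ≤ β₂) (hε₁ : 0 ≤ ε₁)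
    (hg : 0 ≤ β₁ - ((U.card : ℝ) - 1) / (Uᶜ.card : ℝ) * ε₁) (s : ℕ → V) (j : ℕ) (v : V) :
    0 ≤ protocol U β₁ β₂ ε₁ s j v := by
  unfold protocol protocolU protocolL
  split_ifs <;> positivity

/-- Every cut collects at least the active nodes in its second part, at no less than
`collectCost`. -/
lemma exists_collectCost_le_cutWeight {U : Finset V} {β₁ β₂ ε₁ : ℝ} (hβ₂ : 0 ≤ β₂)
    (hβ₁ : 0 ≤ β₁) (hε₁ : 0 ≤ ε₁) (hg : β₂ ≤ β₁ - ((U.card : ℝ) - 1) / (Uᶜ.card : ℝ) * ε₁)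
    (s : ℕ → V) (j : ℕ) {T : Finset (FlowNode V)} (hT : FlowNode.source ∉ T)
    (hfin : cutWeight s (protocol U β₁ β₂ ε₁ s) j T ≠ ⊤) :
    ∃ B : Finset V, (∀ v, FlowNode.storage v (label s j v) ∈ T → v ∈ B) ∧
      ENNReal.ofReal (collectCost U.card Uᶜ.card (β₁ + ε₁)
        (β₁ - ((U.card : ℝ) - 1) / (Uᶜ.card : ℝ) * ε₁) β₂ (B ∩ U).card (B ∩ Uᶜ).card)
        ≤ cutWeight s (protocol U β₁ β₂ ε₁ s) j T := by
  induction j with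
  | zero =>
    refine ⟨∅, fun v hv => ?_, by simp [collectCost]⟩
    rw [cutWeight_zero _ _ hT] at hfin
    -- An original node in `T` would cut an infinite edge from the source.
    exact absurd (WithTop.sum_eq_top.2 ⟨v, Finset.mem_univ v, if_pos hv⟩) hfin
  | succ j ih =>
    rw [cutWeight_succ] at hfin ⊢
    have hfin2 := (ENNReal.add_ne_top.1 hfin).2
    have hfin1 := (ENNReal.add_ne_top.1 (ENNReal.add_ne_top.1 hfin).1).1
    obtain ⟨B, hAB, hB⟩ := ih hfin1
    by_cases hr : FlowNode.repair j ∈ T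
    · simp only [hr, if_true, not_true, false_and, if_false, add_zero]
      refine ⟨insert (s j) B, fun v hv => ?_, ?_⟩
      · by_cases hvs : v = s j
        · simp [hvs]
        · exact Finset.mem_insert_of_mem (hAB v (by simpa [label, hvs] using hv))
      -- A second repair of a collected node only adds weight; `B` need not grow.
      by_cases hsB : s j ∈ B
      · rw [Finset.insert_eq_of_mem hsB]
        exact hB.trans le_self_add
      have hcost : ENNReal.ofReal (∑ u ∈ Finset.univ.filter (fun u => u ≠ s j ∧ u ∉ B),
          protocol U β₁ β₂ ε₁ s j u) ≤ repairCost s (protocol U β₁ β₂ ε₁ s) j T := by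
        rw [ENNReal.ofReal_sum_of_nonneg
          fun u _ => protocol_nonneg hβ₁ hβ₂ hε₁ (hβ₂.trans hg) s j u]
        refine Finset.sum_le_sum_of_subset fun u hu => ?_
        simp only [Finset.mem_filter, Finset.mem_univ, true_and] at hu ⊢
        exact ⟨hu.1, fun h => hu.2 (hAB u h)⟩
      refine le_trans ?_ (add_le_add hB hcost)
      refine le_trans (ENNReal.ofReal_le_ofReal ?_) ENNReal.ofReal_add_le
      by_cases hsU : s j ∈ U
      · rw [sum_protocol_of_mem U B β₁ β₂ ε₁ hsU hsB, Finset.insert_inter_of_mem hsU,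
          Finset.insert_inter_of_notMem (by simpa using hsU),
          Finset.card_insert_of_notMem (by simp [hsB]), Nat.cast_succ]
        exact collectCost_add_left_le hg (Nat.cast_nonneg _)
      · rw [sum_protocol_of_notMem U B β₁ β₂ ε₁ hsU hsB, Finset.insert_inter_of_notMem hsU,
          Finset.insert_inter_of_mem (by simpa using hsU),
          Finset.card_insert_of_notMem (by simp [hsB]), Nat.cast_succ]
        exact (collectCost_add_right ..).le
    · refine ⟨B, fun v hv => ?_, hB.trans (le_trans le_self_add le_self_add)⟩
      by_cases hvs : v = s j
      -- A newcomer in `T` without its repair unit would cut an infinite edge.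
      · subst hvs
        simp only [label, if_true] at hv
        simp [hr, hv] at hfin2
      · exact hAB v (by simpa [label, hvs] using hv)

/-- The excess over the value at `x = m₁`, `y = k - m₁` is written in `key` as a sum of visibly
nonnegative terms. -/
lemma le_collectCost {m₁ m₂ k β₁ β₂ ε₁ x y : ℝ} (hm₁ : 2 ≤ m₁) (hm₂ : 0 < m₂) (hβ₂ : 0 ≤ β₂)
    (hε₁ : 0 ≤ ε₁) (hassump : (m₁ + m₂) * (m₁ - 1) / m₂ * ε₁ ≤ β₁ - β₂)
    (hk : m₁ ≤ k) (hx : x = m₁ ∨ x ≤ m₁ - 1) (hy : y = m₂ ∨ y ≤ m₂ - 1)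
    (hxy : x + y = k ∨ k + 1 ≤ x + y) :
    m₁ * (m₁ - 1) / 2 * (β₁ + ε₁) + (m₂ * k - (k - m₁) * (k - m₁ + 1) / 2) * β₂
      ≤ collectCost m₁ m₂ (β₁ + ε₁) (β₁ - (m₁ - 1) / m₂ * ε₁) β₂ x y := by
  set r := (m₁ - 1) / m₂ * ε₁ with hr
  have hr0 : 0 ≤ r := mul_nonneg (div_nonneg (by linarith) hm₂.le) hε₁
  -- Since `m₂ * r = (m₁ - 1) * ε₁`, the left side is `(m₁ + m₂) * r`.
  have hass : m₁ * r + (m₁ - 1) * ε₁ ≤ β₁ - β₂ := by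
    convert hassump using 1
    rw [hr]; field_simp
  have hgc : β₂ ≤ β₁ - r := by nlinarith
  -- `m` counts the missing nodes of `U`, `a` is `k - m₁`, and `t` is the surplus of `x + y` over
  -- `k`.
  obtain ⟨m, rfl⟩ : ∃ m, x = m₁ - m := ⟨m₁ - x, by ring⟩
  obtain ⟨a, rfl⟩ : ∃ a, k = m₁ + a := ⟨k - m₁, by ring⟩
  obtain ⟨t, rfl⟩ : ∃ t, y = a + m + t := ⟨y - a - m, by ring⟩
  have hm : m = 0 ∨ 1 ≤ m := by
    rcases hx with h | h
    · left; linarith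
    · right; linarith
  have hm0 : 0 ≤ m := by rcases hm with h | h <;> linarith
  have ha : 0 ≤ a := by linarith
  -- The gap between 0 and 1 makes `t * (t - 1)` nonnegative.
  have ht : t = 0 ∨ 1 ≤ t := by
    rcases hxy with h | h
    · left; linarith
    · right; linarith
  have ht0 : 0 ≤ t := by rcases ht with h | h <;> linarith
  have hyle : a + m + t ≤ m₂ := by rcases hy with h | h <;> linarith
  have key : collectCost m₁ m₂ (β₁ + ε₁) (β₁ - r) β₂ (m₁ - m) (a + m + t)
      - (m₁ * (m₁ - 1) / 2 * (β₁ + ε₁)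
        + (m₂ * (m₁ + a) - ((m₁ + a) - m₁) * ((m₁ + a) - m₁ + 1) / 2) * β₂)
      = a * m * (β₁ - r - β₂)
        + m * ((m + 1) / 2 * (β₁ - β₂ - (m₁ * r + (m₁ - 1) * ε₁))
          + r * ((m + 1) / 2 * m₁ - m) + ε₁ * ((m + 1) / 2 * (m₁ - 1) - (m - 1) / 2))
        + t * (m * (β₁ - r) + β₂ * (m₂ - (a + m + t) + (t - 1) / 2)) := by
    unfold collectCost; ring
  have h1 : 0 ≤ a * m * (β₁ - r - β₂) := mul_nonneg (mul_nonneg ha hm0) (by linarith)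
  have h2 : 0 ≤ (m + 1) / 2 * m₁ - m := by nlinarith
  have h3 : 0 ≤ (m + 1) / 2 * (m₁ - 1) - (m - 1) / 2 := by nlinarith
  have h4 : 0 ≤ (m + 1) / 2 * (β₁ - β₂ - (m₁ * r + (m₁ - 1) * ε₁)) :=
    mul_nonneg (by linarith) (by linarith)
  have h5 : 0 ≤ t * (m * (β₁ - r) + β₂ * (m₂ - (a + m + t) + (t - 1) / 2)) := by
    rcases ht with rfl | h
    · simp
    · have h6 : 0 ≤ m * (β₁ - r) := mul_nonneg hm0 (by linarith)
      have h7 : 0 ≤ β₂ * (m₂ - (a + m + t) + (t - 1) / 2) := mul_nonneg hβ₂ (by linarith)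
      exact mul_nonneg ht0 (by linarith)
  have h8 := mul_nonneg hr0 h2
  have h9 := mul_nonneg hε₁ h3
  have h10 := mul_nonneg hm0 (add_nonneg (add_nonneg h4 h8) h9)
  linarith

lemma card_inter_add_card_inter_compl (B U : Finset V) :
    (B ∩ U).card + (B ∩ Uᶜ).card = B.card := by
  rw [← Finset.card_inter_add_card_sdiff B U, Finset.sdiff_eq_inter_compl]

/-- Only the source is required in `A`, so the bound serves both the capacity and the static cut. -/
lemma ofReal_le_minCut_protocol {U : Finset V} {k : ℕ} {β₁ β₂ ε₁ : ℝ} (hU : 2 ≤ U.card)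
    (hL : 0 < Uᶜ.card) (hβ₂ : 0 ≤ β₂) (hβ₁ : 0 ≤ β₁) (hε₁ : 0 ≤ ε₁) (hk : U.card ≤ k)
    (hassump : ((U.card : ℝ) + Uᶜ.card) * ((U.card : ℝ) - 1) / Uᶜ.card * ε₁ ≤ β₁ - β₂)
    (s : ℕ → V) (j : ℕ) {A D : Finset (FlowNode V)} (hA : FlowNode.source ∈ A)
    (hD : D ∈ (activeNodes s j).powersetCard k) :
    ENNReal.ofReal ((U.card : ℝ) * ((U.card : ℝ) - 1) / 2 * (β₁ + ε₁)
        + ((Uᶜ.card : ℝ) * k - ((k : ℝ) - U.card) * ((k : ℝ) - U.card + 1) / 2) * β₂)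
      ≤ minCut s (protocol U β₁ β₂ ε₁ s) j A D := by
  refine le_iInf fun T => le_iInf fun _ => le_iInf fun hAT => le_iInf fun hDT => ?_
  by_cases hfin : cutWeight s (protocol U β₁ β₂ ε₁ s) j T = ⊤
  · rw [hfin]; exact le_top
  have hU' : (2 : ℝ) ≤ U.card := by exact_mod_cast hU
  have hL' : (0 : ℝ) < Uᶜ.card := by exact_mod_cast hL
  have hg : β₂ ≤ β₁ - ((U.card : ℝ) - 1) / (Uᶜ.card : ℝ) * ε₁ := by
    have h0 : 0 ≤ ((U.card : ℝ) - 1) / (Uᶜ.card : ℝ) * ε₁ :=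
      mul_nonneg (div_nonneg (by linarith) hL'.le) hε₁
    have h1 : ((U.card : ℝ) + Uᶜ.card) * ((U.card : ℝ) - 1) / Uᶜ.card * ε₁
        = ((U.card : ℝ) + Uᶜ.card) * (((U.card : ℝ) - 1) / (Uᶜ.card : ℝ) * ε₁) := by ring
    nlinarith
  obtain ⟨B, hB, hcost⟩ := exists_collectCost_le_cutWeight hβ₂ hβ₁ hε₁ hg s j
    (Finset.disjoint_left.1 hAT hA) hfin
  refine le_trans (ENNReal.ofReal_le_ofReal ?_) hcost
  rw [Finset.mem_powersetCard] at hD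
  have hkB : k ≤ B.card := by
    rw [← hD.2]
    refine (Finset.card_le_card (t := B.image fun v => FlowNode.storage v (label s j v))
      fun d hd => ?_).trans Finset.card_image_le
    obtain ⟨v, -, rfl⟩ := Finset.mem_image.1 (hD.1 hd)
    exact Finset.mem_image_of_mem _ (hB v (hDT hd))
  have hcard := card_inter_add_card_inter_compl B U
  have hx : (B ∩ U).card = U.card ∨ (B ∩ U).card + 1 ≤ U.card := by
    have := Finset.card_le_card (Finset.inter_subset_right : B ∩ U ⊆ U); omega
  have hy : (B ∩ Uᶜ).card = Uᶜ.card ∨ (B ∩ Uᶜ).card + 1 ≤ Uᶜ.card := by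
    have := Finset.card_le_card (Finset.inter_subset_right : B ∩ Uᶜ ⊆ Uᶜ); omega
  have hxy : (B ∩ U).card + (B ∩ Uᶜ).card = k ∨ k + 1 ≤ (B ∩ U).card + (B ∩ Uᶜ).card := by omega
  refine le_collectCost hU' hL' hβ₂ hε₁ hassump (by exact_mod_cast hk) ?_ ?_
    (by exact_mod_cast hxy)
  · rw [le_sub_iff_add_le]; exact_mod_cast hx
  · rw [le_sub_iff_add_le]; exact_mod_cast hy

/-! ### A failure sequence attaining the static cut -/

lemma hStar_fixedCost (U : Finset V) (β₁ β₂ : ℝ) (s : ℕ → V) :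
    hStar (fixedCost U β₁ β₂) s = protocol U β₁ β₂ 0 s := by
  funext j v
  simp [hStar, fixedCost, protocol, protocolU, protocolL]

lemma label_of_lt {V : Type*} [DecidableEq V] {s : ℕ → V} {j i : ℕ}
    (hs : Set.InjOn s (Set.Iio j)) (hi : i < j) :
    label s j (s i) = i + 1 := by
  induction j with
  | zero => omega
  | succ j ih =>
    by_cases hij : i = j
    · simp [label, hij]
    · have hlt : i < j := by omega
      have hne : s i ≠ s j := fun h => hij (hs (by simpa using hi) (by simp) h)
      simp only [label, hne, if_false]
      exact ih (hs.mono (Set.Iio_subset_Iio (Nat.le_succ j))) hlt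

lemma label_of_notMem {V : Type*} [DecidableEq V] {s : ℕ → V} {j : ℕ} {v : V}
    (hv : v ∉ (Finset.range j).image s) :
    label s j v = 0 := by
  induction j with
  | zero => rfl
  | succ j ih =>
    rw [Finset.range_add_one, Finset.image_insert, Finset.mem_insert, not_or] at hv
    simp only [label, hv.1, if_false]
    exact ih hv.2

/-- The newcomers of the first `k` failures. -/
def newcomers (s : ℕ → V) (k : ℕ) : Finset (FlowNode V) :=
  (Finset.range k).image fun i => FlowNode.storage (s i) (i + 1)

/-- The newcomers and the repair units of the first `k` failures. -/
def repairCut (s : ℕ → V) (k : ℕ) : Finset (FlowNode V) :=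
  newcomers s k ∪ (Finset.range k).image FlowNode.repair

lemma repairCut_subset_flowVertices (s : ℕ → V) (k : ℕ) : repairCut s k ⊆ flowVertices s k := by
  induction k with
  | zero => simp [repairCut, newcomers]
  | succ k ih =>
    intro x hx
    simp only [repairCut, newcomers, Finset.range_add_one, Finset.image_insert, Finset.mem_union,
      Finset.mem_insert] at hx
    simp only [flowVertices, Finset.mem_union, Finset.mem_insert, Finset.mem_singleton]
    rcases hx with (h | h) | (h | h)
    · exact Or.inr (Or.inr h)
    · exact Or.inl (ih (Finset.mem_union_left _ h))
    · exact Or.inr (Or.inl h)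
    · exact Or.inl (ih (Finset.mem_union_right _ h))

lemma newcomers_mem_powersetCard {s : ℕ → V} {k : ℕ} (hs : Set.InjOn s (Set.Iio k)) :
    newcomers s k ∈ (activeNodes s k).powersetCard k := by
  rw [Finset.mem_powersetCard]
  constructor
  · intro x hx
    obtain ⟨i, hi, rfl⟩ := Finset.mem_image.1 hx
    rw [← label_of_lt hs (Finset.mem_range.1 hi)]
    exact Finset.mem_image_of_mem _ (Finset.mem_univ _)
  · rw [newcomers, Finset.card_image_of_injective _ (fun i j h => by simp at h; exact h.2),
      Finset.card_range]

/-- Without repeated failures, a node's active copy is either its original, outside the cut, or its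
only newcomer, inside it. So the collected set is exactly the set of nodes failed so far. -/
lemma storage_mem_repairCut_iff {V : Type*} [DecidableEq V] {s : ℕ → V} {k j : ℕ}
    (hs : Set.InjOn s (Set.Iio k)) (hj : j ≤ k) (v : V) :
    FlowNode.storage v (label s j v) ∈ repairCut s k ↔ v ∈ (Finset.range j).image s := by
  constructor
  · intro h
    by_contra hv
    rw [label_of_notMem hv] at h
    simp [repairCut, newcomers] at h
  · intro h
    obtain ⟨i, hi, rfl⟩ := Finset.mem_image.1 h
    rw [Finset.mem_range] at hi
    rw [label_of_lt (hs.mono (Set.Iio_subset_Iio hj)) hi]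
    exact Finset.mem_union_left _
      (Finset.mem_image.2 ⟨i, Finset.mem_range.2 (hi.trans_le hj), rfl⟩)

/-- The collecting bound is tight here because `U` fails before `L`. Nonnegativity is carried along
because `ENNReal.ofReal` is additive only on nonnegative terms. -/
lemma cutWeight_repairCut {U : Finset V} {k : ℕ} {β₁ β₂ : ℝ} (hβ₁ : 0 ≤ β₁) (hβ₂ : 0 ≤ β₂)
    {s : ℕ → V} (hs : Set.InjOn s (Set.Iio k)) (hsU : ∀ i < k, (s i ∈ U ↔ i < U.card))
    {j : ℕ} (hj : j ≤ k) :
    0 ≤ collectCost U.card Uᶜ.card β₁ β₁ β₂ (((Finset.range j).image s) ∩ U).card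
        (((Finset.range j).image s) ∩ Uᶜ).card ∧
    cutWeight s (protocol U β₁ β₂ 0 s) j (repairCut s k)
      = ENNReal.ofReal (collectCost U.card Uᶜ.card β₁ β₁ β₂
          (((Finset.range j).image s) ∩ U).card (((Finset.range j).image s) ∩ Uᶜ).card) := by
  induction j with
  | zero =>
    rw [cutWeight_zero _ _ (by simp [repairCut, newcomers])]
    simp [collectCost, repairCut, newcomers]
  | succ j ih =>
    obtain ⟨h0, hc⟩ := ih (by omega)
    have hr : FlowNode.repair j ∈ repairCut s k := by simp [repairCut]; omega
    have hmem : s j ∉ (Finset.range j).image s := by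
      intro h
      obtain ⟨i, hi, his⟩ := Finset.mem_image.1 h
      rw [Finset.mem_range] at hi
      have := hs (Set.mem_Iio.2 (by omega)) (Set.mem_Iio.2 (by omega)) his
      omega
    have hnn : ∀ u, 0 ≤ protocol U β₁ β₂ 0 s j u :=
      fun u => protocol_nonneg hβ₁ hβ₂ le_rfl (by simpa using hβ₁) s j u
    have hrc : repairCost s (protocol U β₁ β₂ 0 s) j (repairCut s k)
        = ENNReal.ofReal (∑ u ∈ Finset.univ.filter
            (fun u => u ≠ s j ∧ u ∉ (Finset.range j).image s), protocol U β₁ β₂ 0 s j u) := by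
      rw [ENNReal.ofReal_sum_of_nonneg fun u _ => hnn u, repairCost]
      simp only [storage_mem_repairCut_iff hs (Nat.le_of_succ_le hj)]
    have hsum0 : 0 ≤ ∑ u ∈ Finset.univ.filter
        (fun u => u ≠ s j ∧ u ∉ (Finset.range j).image s), protocol U β₁ β₂ 0 s j u :=
      Finset.sum_nonneg fun u _ => hnn u
    have hstep : collectCost U.card Uᶜ.card β₁ β₁ β₂
          (((Finset.range (j + 1)).image s) ∩ U).card (((Finset.range (j + 1)).image s) ∩ Uᶜ).card
        = collectCost U.card Uᶜ.card β₁ β₁ β₂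
          (((Finset.range j).image s) ∩ U).card (((Finset.range j).image s) ∩ Uᶜ).card
          + ∑ u ∈ Finset.univ.filter
            (fun u => u ≠ s j ∧ u ∉ (Finset.range j).image s), protocol U β₁ β₂ 0 s j u := by
      rw [Finset.range_add_one, Finset.image_insert]
      by_cases hU : s j ∈ U
      · rw [sum_protocol_of_mem U _ β₁ β₂ 0 hU hmem, Finset.insert_inter_of_mem hU,
          Finset.insert_inter_of_notMem (by simpa using hU),
          Finset.card_insert_of_notMem (by simp only [Finset.mem_inter, hmem, false_and,
            not_false_eq_true]), Nat.cast_succ]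
        -- While nodes of `U` fail, nothing of `L` is collected, so the slack `y * (g - c)`
        -- vanishes.
        have hempty : (Finset.range j).image s ∩ Uᶜ = ∅ := by
          rw [← Finset.disjoint_iff_inter_eq_empty, disjoint_compl_right_iff]
          intro v hv
          obtain ⟨i, hi, rfl⟩ := Finset.mem_image.1 hv
          rw [Finset.mem_range] at hi
          have := (hsU j (by omega)).1 hU
          exact (hsU i (by omega)).2 (by omega)
        rw [hempty]
        unfold collectCost
        simp only [Finset.card_empty, Nat.cast_zero]
        ring
      · rw [sum_protocol_of_notMem U _ β₁ β₂ 0 hU hmem, Finset.insert_inter_of_notMem hU,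
          Finset.insert_inter_of_mem (by simpa using hU),
          Finset.card_insert_of_notMem (by simp only [Finset.mem_inter, hmem, false_and,
            not_false_eq_true]), Nat.cast_succ, collectCost_add_right]
        ring
    refine ⟨hstep ▸ add_nonneg h0 hsum0, ?_⟩
    rw [cutWeight_succ, hc, if_pos hr, hrc, if_neg (by simp [hr]), add_zero,
      ← ENNReal.ofReal_add h0 hsum0, hstep]

/-- The nodes can be enumerated in such a way that `U` comes first. -/
lemma exists_enum (U : Finset V) (hV : 0 < Fintype.card V) :
    ∃ s : ℕ → V, Set.InjOn s (Set.Iio (Fintype.card V)) ∧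
      ∀ i < Fintype.card V, (s i ∈ U ↔ i < U.card) := by
  obtain ⟨v₀⟩ := Fintype.card_pos_iff.1 hV
  have hlen : (U.toList ++ Uᶜ.toList).length = Fintype.card V := by
    simp [Finset.card_add_card_compl]
  have hnd : (U.toList ++ Uᶜ.toList).Nodup :=
    (Finset.nodup_toList U).append (Finset.nodup_toList _)
      (by intro x; simp)
  refine ⟨fun i => (U.toList ++ Uᶜ.toList).getD i v₀, fun i hi j hj hij => ?_, fun i hi => ?_⟩
  · rw [Set.mem_Iio, ← hlen] at hi hj
    simp only [List.getD_eq_getElem _ _ hi, List.getD_eq_getElem _ _ hj] at hij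
    exact (hnd.getElem_inj_iff).1 hij
  · rw [← hlen] at hi
    simp only [List.getD_eq_getElem _ _ hi]
    by_cases h : i < U.card
    · rw [List.getElem_append_left (by simpa using h)]
      simp only [h, iff_true]
      exact Finset.mem_toList.1 (List.getElem_mem _)
    · rw [List.getElem_append_right (by simpa using h)]
      simp only [h, iff_false]
      exact Finset.mem_compl.1 (Finset.mem_toList.1 (List.getElem_mem _))

lemma staticCut_le {U : Finset V} {k : ℕ} {β₁ β₂ : ℝ} (hβ₁ : 0 ≤ β₁) (hβ₂ : 0 ≤ β₂)
    (hk : U.card < k) (hkn : k ≤ Fintype.card V) :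
    staticCut k (fixedCost U β₁ β₂) ≤
      ENNReal.ofReal ((U.card : ℝ) * ((U.card : ℝ) - 1) / 2 * β₁
        + ((Uᶜ.card : ℝ) * k - ((k : ℝ) - U.card) * ((k : ℝ) - U.card + 1) / 2) * β₂) := by
  obtain ⟨s, hs, hsU⟩ := exists_enum U (by omega)
  replace hs := hs.mono (Set.Iio_subset_Iio hkn)
  replace hsU : ∀ i < k, (s i ∈ U ↔ i < U.card) := fun i hi => hsU i (by omega)
  have hcut : staticCut k (fixedCost U β₁ β₂)
      ≤ cutWeight s (hStar (fixedCost U β₁ β₂) s) k (repairCut s k) := by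
    unfold staticCut cutAt minCut
    refine iInf_le_of_le s (iInf_le_of_le k ?_)
    refine iInf_le_of_le (newcomers s k) (iInf_le_of_le (newcomers_mem_powersetCard hs) ?_)
    refine iInf_le_of_le (repairCut s k) (iInf_le_of_le (repairCut_subset_flowVertices s k) ?_)
    refine iInf_le_of_le ?_ (iInf_le_of_le Finset.subset_union_left le_rfl)
    rw [Finset.disjoint_left]
    intro x hx hxT
    rcases Finset.mem_union.1 hxT with h | h
    · exact (Finset.mem_sdiff.1 hx).2
        ((Finset.mem_powersetCard.1 (newcomers_mem_powersetCard hs)).1 h)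
    · obtain ⟨i, -, rfl⟩ := Finset.mem_image.1 h
      simp [activeNodes] at hx
  rw [hStar_fixedCost, (cutWeight_repairCut hβ₁ hβ₂ hs hsU le_rfl).2] at hcut
  refine hcut.trans (ENNReal.ofReal_le_ofReal (le_of_eq ?_))
  have hB : ((Finset.range k).image s).card = k := by
    rw [Finset.card_image_of_injOn (by simpa using hs), Finset.card_range]
  have hBU : (Finset.range k).image s ∩ U = (Finset.range U.card).image s := by
    ext v
    simp only [Finset.mem_inter, Finset.mem_image, Finset.mem_range]
    constructor
    · rintro ⟨⟨i, hi, rfl⟩, hv⟩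
      exact ⟨i, (hsU i hi).1 hv, rfl⟩
    · rintro ⟨i, hi, rfl⟩
      exact ⟨⟨i, hi.trans hk, rfl⟩, (hsU i (hi.trans hk)).2 hi⟩
  have hx : ((Finset.range k).image s ∩ U).card = U.card := by
    rw [hBU, Finset.card_image_of_injOn
      (by simpa using hs.mono (Set.Iio_subset_Iio hk.le)), Finset.card_range]
  have hy : ((((Finset.range k).image s ∩ Uᶜ).card : ℕ) : ℝ) = k - U.card := by
    have := card_inter_add_card_inter_compl ((Finset.range k).image s) U
    rw [hx, hB] at this
    rw [eq_sub_iff_add_eq, add_comm]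
    exact_mod_cast this
  rw [hx, hy]
  unfold collectCost
  ring

/-! ### Average bandwidth -/

/-- For `v ∈ U` the surplus `ε₁` occurs for `n₁ - 1` failed nodes and the reduction `(n₁ - 1) / n₂ *
ε₁` for `n₂` of them, so they cancel. The missing summand is the failure of `v` itself. -/
lemma sum_protocol_failed {U : Finset V} (hL : (Uᶜ.card : ℝ) ≠ 0) (β₁ β₂ ε₁ : ℝ) (v : V) :
    ∑ x : V, protocol U β₁ β₂ ε₁ (fun _ => x) 0 v
      = ((Fintype.card V : ℝ) - 1) * fixedCost U β₁ β₂ v := by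
  have hcard : (Fintype.card V : ℝ) = U.card + Uᶜ.card := by
    rw [← Finset.card_add_card_compl U]; push_cast; rfl
  have hpt : ∀ (A : Finset V) (b : ℝ), ∑ x ∈ A, (if v = x then 0 else b)
      = A.card * b - if v ∈ A then b else 0 := by
    intro A b
    rw [← Finset.sum_ite_eq A v (fun _ => b), ← nsmul_eq_mul, ← Finset.sum_const,
      ← Finset.sum_sub_distrib]
    refine Finset.sum_congr rfl fun x _ => ?_
    split_ifs <;> simp
  rw [← Finset.sum_add_sum_compl U,
    Finset.sum_congr (s₁ := U) rfl (g := fun x => if v = x then 0 else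
      if v ∈ U then β₁ + ε₁ else β₂)
      (fun x hx => by simp [protocol, protocolU, hx]),
    Finset.sum_congr (s₁ := Uᶜ) rfl (g := fun x => if v = x then 0 else
      if v ∈ U then β₁ - ((U.card : ℝ) - 1) / (Uᶜ.card : ℝ) * ε₁ else β₂)
      (fun x hx => by simp [protocol, protocolL, Finset.mem_compl.1 hx]), hpt, hpt, hcard]
  by_cases hv : v ∈ U
  · simp only [hv, Finset.mem_compl, not_true, if_true, if_false, fixedCost]
    field_simp
    ring
  · simp only [hv, Finset.mem_compl, not_false_iff, if_true, if_false, fixedCost]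
    ring

/-- For independent uniform failures, time averages of functions of the failed node converge
almost surely to the average over all nodes. -/
lemma tendsto_average_of_iIndepFun_uniform {Ω V : Type*} [Fintype V] [MeasurableSpace Ω] {P : Measure Ω}
    [IsProbabilityMeasure P] [MeasurableSpace V] [MeasurableSingletonClass V]
    {S : ℕ → Ω → V} (hS : ∀ j, Measurable (S j)) (hindep : iIndepFun S P)
    (hunif : ∀ j v, P {ω | S j ω = v} = 1 / (Fintype.card V : ℝ≥0∞)) (F : V → ℝ) :
    ∀ᵐ ω ∂P, Tendsto (fun l : ℕ => (∑ j ∈ Finset.range l, F (S j ω)) / (l : ℝ)) atTop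
      (nhds ((∑ x : V, F x) / Fintype.card V)) := by
  have hF : Measurable F := measurable_of_countable F
  have hmap : ∀ j v, (P.map (S j)) {v} = 1 / (Fintype.card V : ℝ≥0∞) := fun j v => by
    rw [Measure.map_apply (hS j) (measurableSet_singleton v)]; exact hunif j v
  have hid : ∀ j, IdentDistrib (fun ω => F (S j ω)) (fun ω => F (S 0 ω)) P P := fun j =>
    IdentDistrib.comp ⟨(hS j).aemeasurable, (hS 0).aemeasurable,
      Measure.ext_of_singleton fun v => by rw [hmap, hmap]⟩ hF
  have : IsProbabilityMeasure (P.map (S 0)) :=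
    Measure.isProbabilityMeasure_map (hS 0).aemeasurable
  have hint : Integrable (fun ω => F (S 0 ω)) P :=
    (Integrable.of_finite (μ := P.map (S 0)) (f := F)).comp_measurable (hS 0)
  have hE : ∫ ω, F (S 0 ω) ∂P = (∑ x : V, F x) / Fintype.card V := by
    rw [← integral_map (hS 0).aemeasurable hF.aestronglyMeasurable,
      integral_fintype Integrable.of_finite, Finset.sum_div]
    refine Finset.sum_congr rfl fun v _ => ?_
    rw [measureReal_def, hmap]
    simp [div_eq_inv_mul]
  rw [← hE]
  exact strong_law_ae_real (fun j ω => F (S j ω)) hint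
    (fun i j hij => (hindep.indepFun hij).comp hF hF) hid

lemma ae_admissible_protocol {Ω : Type*} [MeasurableSpace Ω] {P : Measure Ω}
    [IsProbabilityMeasure P] [MeasurableSpace V] [MeasurableSingletonClass V]
    {S : ℕ → Ω → V} (hS : ∀ j, Measurable (S j)) (hindep : iIndepFun S P)
    (hunif : ∀ j v, P {ω | S j ω = v} = 1 / (Fintype.card V : ℝ≥0∞))
    {U : Finset V} {β₁ β₂ ε₁ : ℝ} (hL : 0 < Uᶜ.card) (hβ₁ : 0 ≤ β₁) (hβ₂ : 0 ≤ β₂)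
    (hε₁ : 0 ≤ ε₁) (hg : 0 ≤ β₁ - ((U.card : ℝ) - 1) / (Uᶜ.card : ℝ) * ε₁) :
    ∀ᵐ ω ∂P, Admissible (fixedCost U β₁ β₂) (protocol U β₁ β₂ ε₁ (fun j => S j ω)) := by
  have hlim := ae_all_iff.2 fun v : V => tendsto_average_of_iIndepFun_uniform hS hindep hunif
    (fun x => protocol U β₁ β₂ ε₁ (fun _ => x) 0 v)
  filter_upwards [hlim] with ω hω
  refine ⟨fun j v => protocol_nonneg hβ₁ hβ₂ hε₁ hg _ j v, fun v => ?_⟩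
  have hcont := (continuous_coe_real_ereal.tendsto _).comp (hω v)
  rw [sum_protocol_failed (by positivity)] at hcont
  refine (Tendsto.limsup_eq hcont).trans_le (EReal.coe_le_coe_iff.2 ?_)
  have hβ : 0 ≤ fixedCost U β₁ β₂ v := by unfold fixedCost; split_ifs <;> assumption
  have hV : (0 : ℝ) < Fintype.card V := by exact_mod_cast Fintype.card_pos_iff.2 ⟨v⟩
  -- The limit is `(n - 1) / n` times the budget, hence within it.
  rw [div_le_iff₀ hV]
  nlinarith

end StorageNetwork

/-! ### Assembly of the theorem -/

theorem mainTheorem2 {Ω V : Type*} [MeasurableSpace Ω] (P : Measure Ω) [IsProbabilityMeasure P]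
    [Fintype V] [DecidableEq V] [MeasurableSpace V] [MeasurableSingletonClass V]
    (U : Finset V) (n n₁ n₂ k : ℕ)
    (hn : Fintype.card V = n) (hU : U.card = n₁) (hL : Uᶜ.card = n₂)
    (hn₁ : 2 ≤ n₁) (hn₂ : 2 ≤ n₂) (hk : n₁ < k) (hkn : k ≤ n)
    (β₁ β₂ : ℝ) (hβ₂ : 0 < β₂) (hβ : β₂ ≤ β₁)
    (S : ℕ → Ω → V) (hS : ∀ j, Measurable (S j)) (hindep : iIndepFun S P)
    (hunif : ∀ j v, P {ω | S j ω = v} = 1 / (n : ℝ≥0∞))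
    (ε₁ : ℝ) (hε₁ : 0 ≤ ε₁)
    (hassump : (n : ℝ) * ((n₁ : ℝ) - 1) / (n₂ : ℝ) * ε₁ ≤ β₁ - β₂) :
    StorageNetwork.staticCut k (StorageNetwork.fixedCost U β₁ β₂) =
        ENNReal.ofReal ((n₁ : ℝ) * ((n₁ : ℝ) - 1) / 2 * β₁ +
          ((n₂ : ℝ) * (k : ℝ) - ((k : ℝ) - n₁) * ((k : ℝ) - n₁ + 1) / 2) * β₂) ∧
    ∀ᵐ ω ∂P,
      StorageNetwork.Admissible (StorageNetwork.fixedCost U β₁ β₂)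
          (StorageNetwork.protocol U β₁ β₂ ε₁ (fun j => S j ω)) ∧
      StorageNetwork.staticCut k (StorageNetwork.fixedCost U β₁ β₂) +
          ENNReal.ofReal ((n₁ : ℝ) * ((n₁ : ℝ) - 1) / 2 * ε₁) ≤
        StorageNetwork.capWith k (fun j => S j ω)
          (StorageNetwork.protocol U β₁ β₂ ε₁ (fun j => S j ω)) ∧
      StorageNetwork.staticCut k (StorageNetwork.fixedCost U β₁ β₂) +
          ENNReal.ofReal ((n₁ : ℝ) * ((n₁ : ℝ) - 1) / 2 * ε₁) ≤
        StorageNetwork.cap k (StorageNetwork.fixedCost U β₁ β₂) (fun j => S j ω) := by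
  subst hn hU hL
  have hcard : (Fintype.card V : ℝ) = U.card + Uᶜ.card := by
    rw [← Finset.card_add_card_compl U]; push_cast; rfl
  rw [hcard] at hassump
  have hU2 : (2 : ℝ) ≤ U.card := by exact_mod_cast hn₁
  have hL2 : (2 : ℝ) ≤ Uᶜ.card := by exact_mod_cast hn₂
  have hL0 : 0 < Uᶜ.card := by omega
  have hβ₁ : 0 ≤ β₁ := hβ₂.le.trans hβ
  have hg : 0 ≤ β₁ - ((U.card : ℝ) - 1) / (Uᶜ.card : ℝ) * ε₁ := by
    have h0 : 0 ≤ ((U.card : ℝ) - 1) / (Uᶜ.card : ℝ) * ε₁ :=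
      mul_nonneg (div_nonneg (by linarith) (by linarith)) hε₁
    have h1 : ((U.card : ℝ) + Uᶜ.card) * ((U.card : ℝ) - 1) / Uᶜ.card * ε₁
        = ((U.card : ℝ) + Uᶜ.card) * (((U.card : ℝ) - 1) / (Uᶜ.card : ℝ) * ε₁) := by ring
    nlinarith
  have hstatic : StorageNetwork.staticCut k (StorageNetwork.fixedCost U β₁ β₂) =
      ENNReal.ofReal ((U.card : ℝ) * ((U.card : ℝ) - 1) / 2 * β₁ +
        ((Uᶜ.card : ℝ) * (k : ℝ) - ((k : ℝ) - U.card) * ((k : ℝ) - U.card + 1) / 2) * β₂) := by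
    refine le_antisymm (StorageNetwork.staticCut_le hβ₁ hβ₂.le hk hkn) ?_
    refine le_iInf fun s => le_iInf fun j => le_iInf fun D => le_iInf fun hD => ?_
    rw [StorageNetwork.hStar_fixedCost]
    have := StorageNetwork.ofReal_le_minCut_protocol (U := U) (ε₁ := 0) hn₁ hL0 hβ₂.le hβ₁ le_rfl
      hk.le (by simpa using hβ) s j
      (A := insert StorageNetwork.FlowNode.source ((Finset.range j).biUnion
        (StorageNetwork.activeNodes s)) \ StorageNetwork.activeNodes s j)
      (by simp [StorageNetwork.activeNodes]) hD
    rwa [add_zero] at this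
  have hcap : ∀ s : ℕ → V, StorageNetwork.staticCut k (StorageNetwork.fixedCost U β₁ β₂) +
      ENNReal.ofReal ((U.card : ℝ) * ((U.card : ℝ) - 1) / 2 * ε₁) ≤
        StorageNetwork.capWith k s (StorageNetwork.protocol U β₁ β₂ ε₁ s) := by
    intro s
    have hk' : (U.card : ℝ) ≤ k := by exact_mod_cast hk.le
    have hkn' : (k : ℝ) ≤ U.card + Uᶜ.card := by rw [← hcard]; exact_mod_cast hkn
    have hC : 0 ≤ (U.card : ℝ) * ((U.card : ℝ) - 1) / 2 * β₁ +
        ((Uᶜ.card : ℝ) * (k : ℝ) - ((k : ℝ) - U.card) * ((k : ℝ) - U.card + 1) / 2) * β₂ := by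
      refine add_nonneg (mul_nonneg (by nlinarith) hβ₁) (mul_nonneg ?_ hβ₂.le)
      have : ((k : ℝ) - U.card) * ((k : ℝ) - U.card + 1) ≤ Uᶜ.card * k :=
        mul_le_mul (by linarith) (by linarith) (by linarith) (by linarith)
      nlinarith
    rw [hstatic, ← ENNReal.ofReal_add hC (mul_nonneg (by nlinarith) hε₁)]
    refine le_iInf fun j => le_iInf fun D => le_iInf fun hD => ?_
    refine le_trans (ENNReal.ofReal_le_ofReal (le_of_eq ?_))
      (StorageNetwork.ofReal_le_minCut_protocol hn₁ hL0 hβ₂.le hβ₁ hε₁ hk.le hassump s j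
        (Finset.mem_singleton_self _) hD)
    ring
  refine ⟨hstatic, ?_⟩
  filter_upwards [StorageNetwork.ae_admissible_protocol hS hindep hunif hL0 hβ₁ hβ₂.le hε₁ hg]
    with ω hω
  exact ⟨hω, hcap _, (hcap _).trans
    (le_iSup₂ (f := fun h (_ : StorageNetwork.Admissible (StorageNetwork.fixedCost U β₁ β₂) h) =>
      StorageNetwork.capWith k (fun j => S j ω) h) _ hω)⟩
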